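/- Let $S$ be a numerical semigroup, i.e. a submonoid of $(\mathbb{N},+)$ (with $0\in\mathbb{N}$) whose complement in $\mathbb{N}$ is finite. Let $f(S)$ be its Frobenius number, the largest integer not in $S$ (so $f(\mathbb{N})=-1$); let $m(S)$ be its multiplicity, the smallest positive element of $S$; let $\nu(S)$ be its embedding dimension, the number of elements of its unique minimal system of generators; and let $n(S)=|\{s\in S : s<f(S)\}|$. If $2\nu(S)\ge m(S)$, then $S$ satisfies Wilf's conjecture, that is, \[ f(S)+1\le n(S)\,\nu(S). \] -/

import Mathlib

namespace NumericalSemigroup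

/-- A numerical semigroup: a submonoid of `(ℕ, +)` with finite complement in `ℕ`. -/
def IsNumericalSemigroup (S : AddSubmonoid ℕ) : Prop :=
  ((S : Set ℕ)ᶜ).Finite

/-- The Frobenius number: the largest integer not belonging to `S`
(so it is `-1` for `S = ℕ`). -/
noncomputable def frobenius (S : AddSubmonoid ℕ) : ℤ :=
  sSup {z : ℤ | ¬ ∃ s ∈ S, (s : ℤ) = z}

/-- The multiplicity: the smallest positive element of `S`. -/
noncomputable def multiplicity (S : AddSubmonoid ℕ) : ℕ :=
  sInf {s : ℕ | s ∈ S ∧ 0 < s}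

/-- The order `s ⪯ t` induced by `S`: there is `u ∈ S` with `s + u = t`. -/
def Below (S : AddSubmonoid ℕ) (s t : ℕ) : Prop :=
  ∃ u ∈ S, s + u = t

/-- The minimal system of generators of `S`: the minimal elements of `S \ {0}` for the order
induced by `S`. By `isLeast_minimalGenerators` it is the least generating set of `S`. -/
def minimalGenerators (S : AddSubmonoid ℕ) : Set ℕ :=
  {g : ℕ | g ∈ S ∧ g ≠ 0 ∧ ∀ s ∈ S, s ≠ 0 → Below S s g → s = g}

/-- The embedding dimension: the number of minimal generators of `S`. -/
noncomputable def embeddingDimension (S : AddSubmonoid ℕ) : ℕ :=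
  (minimalGenerators S).ncard

/-- The number of elements of `S` smaller than the Frobenius number. -/
noncomputable def numSmall (S : AddSubmonoid ℕ) : ℕ :=
  {s : ℕ | s ∈ S ∧ (s : ℤ) < frobenius S}.ncard

/-- Wilf's inequality `f(S) + 1 ≤ n(S) ν(S)`. -/
def SatisfiesWilf (S : AddSubmonoid ℕ) : Prop :=
  frobenius S + 1 ≤ (numSmall S : ℤ) * (embeddingDimension S : ℤ)

/-- The supremum defining the Frobenius number is attained. -/
theorem isGreatest_frobenius {S : AddSubmonoid ℕ} (hS : IsNumericalSemigroup S) :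
    IsGreatest {z : ℤ | ¬ ∃ s ∈ S, (s : ℤ) = z} (frobenius S) := by
  have hne : {z : ℤ | ¬ ∃ s ∈ S, (s : ℤ) = z}.Nonempty := by
    refine ⟨-1, ?_⟩
    rintro ⟨s, -, hs⟩
    omega
  have hbdd : BddAbove {z : ℤ | ¬ ∃ s ∈ S, (s : ℤ) = z} := by
    obtain ⟨b, hb⟩ := Set.Finite.bddAbove hS
    refine ⟨b, fun z hz => ?_⟩
    by_contra hlt
    push Not at hlt
    have h1 : z.toNat ∈ (S : Set ℕ)ᶜ := fun h => hz ⟨z.toNat, h, by omega⟩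
    have h2 := hb h1
    omega
  exact ⟨Int.csSup_mem hne hbdd, fun z hz => le_csSup hbdd hz⟩

/-- The minimum defining the multiplicity is attained. -/
theorem isLeast_multiplicity {S : AddSubmonoid ℕ} (hS : IsNumericalSemigroup S) :
    IsLeast {s : ℕ | s ∈ S ∧ 0 < s} (multiplicity S) := by
  have hne : {s : ℕ | s ∈ S ∧ 0 < s}.Nonempty := by
    obtain ⟨b, hb⟩ := Set.Finite.bddAbove hS
    refine ⟨b + 1, ?_, by omega⟩
    by_contra h
    have h2 : b + 1 ≤ b := hb h
    omega
  exact ⟨Nat.sInf_mem hne, fun s hs => Nat.sInf_le hs⟩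

/-- The minimal generators generate `S`, and every generating set contains them. -/
theorem isLeast_minimalGenerators (S : AddSubmonoid ℕ) :
    IsLeast {A : Set ℕ | AddSubmonoid.closure A = S} (minimalGenerators S) := by
  constructor
  · apply le_antisymm
    · exact AddSubmonoid.closure_le.mpr fun g hg => hg.1
    · intro s
      induction s using Nat.strong_induction_on with
      | _ s ih =>
        intro hs
        by_cases h0 : s = 0
        · subst h0
          exact zero_mem _
        by_cases hg : s ∈ minimalGenerators S
        · exact AddSubmonoid.subset_closure hg
        · have : ∃ t ∈ S, t ≠ 0 ∧ Below S t s ∧ t ≠ s := by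
            by_contra hcon
            push Not at hcon
            exact hg ⟨hs, h0, hcon⟩
          obtain ⟨t, ht, ht0, ⟨u, hu, rfl⟩, hts⟩ := this
          exact add_mem (ih t (by omega) ht) (ih u (by omega) hu)
  · rintro A rfl g ⟨hg, hg0, hmin⟩
    have key : ∀ x ∈ AddSubmonoid.closure A, x ≠ 0 →
        ∃ a ∈ A, a ≠ 0 ∧ Below (AddSubmonoid.closure A) a x := by
      intro x hx
      induction hx using AddSubmonoid.closure_induction with
      | mem x hx => exact fun h => ⟨x, hx, h, 0, zero_mem _, rfl⟩
      | zero => exact fun h => absurd rfl h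
      | add x y hx hy ihx ihy =>
        intro h
        by_cases hx0 : x = 0
        · obtain ⟨a, ha, ha0, u, hu, he⟩ := ihy (by omega)
          exact ⟨a, ha, ha0, u, hu, by omega⟩
        · obtain ⟨a, ha, ha0, u, hu, he⟩ := ihx hx0
          exact ⟨a, ha, ha0, u + y, add_mem hu hy, by omega⟩
    obtain ⟨a, ha, ha0, hb⟩ := key g hg hg0
    exact hmin a (AddSubmonoid.subset_closure ha) ha0 hb ▸ ha

/-- The set of minimal generators is finite, so its cardinality is meaningful. -/
theorem finite_minimalGenerators {S : AddSubmonoid ℕ} (hS : IsNumericalSemigroup S) :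
    (minimalGenerators S).Finite := by
  obtain ⟨hm, hpos⟩ := (isLeast_multiplicity hS).1
  obtain ⟨b, hb⟩ := Set.Finite.bddAbove hS
  refine (Set.finite_Iic (b + multiplicity S)).subset fun g hg => ?_
  by_contra hlt
  simp only [Set.mem_Iic, not_le] at hlt
  have h1 : g - multiplicity S ∈ S := by
    by_contra h
    have h2 : g - multiplicity S ≤ b := hb h
    omega
  have h3 := hg.2.2 _ hm (by omega) ⟨_, h1, by omega⟩
  omega

end NumericalSemigroup

/-! Count by the Apéry set of `m`. Put F = f + m, let A be the nonzero Apéry elements and D those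
that are not generators, so |D| + e = m with e the embedding dimension; the hypothesis says |D| ≤ e.
Each Apéry element x contributes ⌊(F - x)/m⌋ elements of S below f. Writing m⌊F/m⌋ = (|D| + e)⌊F/m⌋
and cancelling the contribution of x = 0, Wilf's inequality reduces to `card_mul_div_le`.

There, the two least elements a < b of A almost suffice: F ≥ a + b makes ⌊(F - a)/m⌋ + ⌊(F - b)/m⌋
at least ⌊F/m⌋ - 1. If 1 is lost and no other element of A makes up for it, then D ⊆ {2a, a + b,
2b}, and the slack m - 1 - F % m absorbs the loss. If |D| = 1, a alone suffices, since e ≥ 2. -/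

theorem sum_div_add_mod {m x y F : ℕ} (hm : 0 < m) (hxy : x % m ≠ y % m) (h : F ≤ x + y) :
    F / m ≤ x / m + y / m ∨
      F / m = x / m + y / m + 1 ∧ 2 + (x + y - F) ≤ m - 1 - F % m := by
  have h1 := Nat.div_add_mod x m
  have h2 := Nat.div_add_mod y m
  have h3 := Nat.div_add_mod F m
  have l1 := Nat.mod_lt x hm
  have l2 := Nat.mod_lt y hm
  have l3 := Nat.mod_lt F hm
  by_cases hq : F / m ≤ x / m + y / m
  · exact Or.inl hq
  refine Or.inr ?_
  push Not at hq
  have hlt : m * (F / m) < m * (x / m + y / m + 2) := by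
    rw [mul_add, mul_add]; omega
  have hlt' := Nat.lt_of_mul_lt_mul_left hlt
  have heq : F / m = x / m + y / m + 1 := by omega
  have hmul : m * (F / m) = m * (x / m) + m * (y / m) + m := by rw [heq]; ring
  -- Distinct residues sum to at most 2m - 3, which is where the 2 comes from.
  exact ⟨heq, by omega⟩

/-- The Apéry-set form of Wilf's inequality, for a set `A` of integers pairwise incongruent
modulo `m` and a subset `D` of elements that decompose in `A`. -/
theorem card_mul_div_le {A D : Finset ℕ} {m e F : ℕ} (hDA : D ⊆ A) (hA : A.card + 1 = m)
    (hDe : D.card + e = m) (hle : D.card ≤ e) (hF : ∀ x ∈ A, x ≤ F) (hm : ∀ x ∈ A, m < x)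
    (hinj : ∀ x ∈ A, ∀ y ∈ A, x % m = y % m → x = y)
    (hdec : ∀ x ∈ D, ∃ u ∈ A, ∃ v ∈ A, u + v = x) :
    D.card * (F / m) ≤ e * ∑ x ∈ A, (F - x) / m + (m - 1 - F % m) := by
  have hmpos : 0 < m := by omega
  rcases Nat.eq_zero_or_pos D.card with h0 | hpos
  · simp [h0]
  obtain ⟨x₀, hx₀⟩ := Finset.card_pos.mp hpos
  obtain ⟨a, haA, hamin⟩ := Finset.exists_min_image A id ⟨x₀, hDA hx₀⟩
  simp only [id] at hamin
  have hne : (A.erase a).Nonempty := by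
    obtain ⟨u, hu, v, hv, huv⟩ := hdec x₀ hx₀
    refine ⟨x₀, Finset.mem_erase.mpr ⟨?_, hDA hx₀⟩⟩
    have := hm u hu; have := hm v hv; have := hamin u hu; omega
  obtain ⟨b, hbA', hbmin⟩ := Finset.exists_min_image (A.erase a) id hne
  simp only [id] at hbmin
  obtain ⟨hba, hbA⟩ := Finset.mem_erase.mp hbA'
  have hab : a < b := lt_of_le_of_ne (hamin b hbA) (Ne.symm hba)
  have hA2 : 2 ≤ A.card := by
    have := Finset.card_pos.mpr hne
    rw [Finset.card_erase_of_mem haA] at this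
    omega
  have hsum : ∑ x ∈ A, (F - x) / m =
      (F - a) / m + ((F - b) / m + ∑ x ∈ (A.erase a).erase b, (F - x) / m) := by
    rw [← Finset.add_sum_erase A _ haA, ← Finset.add_sum_erase (A.erase a) _ hbA']
  have haF := hF a haA
  have hbF := hF b hbA
  have hma := hm a haA
  have hmF := Nat.div_add_mod F m
  have hFlt := Nat.mod_lt F hmpos
  rcases Nat.lt_or_ge 1 D.card with hd2 | hd1
  · have hFab : a + b ≤ F := by
      obtain ⟨x, hx, y, hy, hxy⟩ := Finset.one_lt_card.mp hd2
      -- The least sum of two elements of A other than 2a is a + b.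
      have key : ∀ z ∈ D, z ≠ 2 * a → a + b ≤ F := by
        intro z hz hza
        obtain ⟨u, hu, v, hv, huv⟩ := hdec z hz
        have hzF := hF z (hDA hz)
        have := hamin u hu
        have := hamin v hv
        by_cases hua : u = a
        · have := hbmin v (Finset.mem_erase.mpr ⟨by omega, hv⟩)
          omega
        · have := hbmin u (Finset.mem_erase.mpr ⟨hua, hu⟩)
          omega
      by_cases hxa : x = 2 * a
      · exact key y hy (by omega)
      · exact key x hx hxa
    have hres : (F - a) % m ≠ (F - b) % m := by
      intro h
      refine hba (hinj b hbA a haA ?_)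
      have h' : F - b ≡ F - a [MOD m] := h.symm
      have h2 := (Nat.ModEq.refl (n := m) (a + b)).add h'
      have e1 : a + b + (F - b) = F + a := by omega
      have e2 : a + b + (F - a) = F + b := by omega
      rw [e1, e2] at h2
      exact (Nat.ModEq.add_left_cancel' F h2).symm
    rcases sum_div_add_mod (F := F) hmpos hres (by omega) with hq | ⟨hq, hloss⟩
    · calc D.card * (F / m) ≤ e * ∑ x ∈ A, (F - x) / m := by
            apply Nat.mul_le_mul hle; omega
        _ ≤ _ := Nat.le_add_right _ _
    by_cases hc : ∃ c ∈ (A.erase a).erase b, m ≤ F - c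
    · obtain ⟨c, hcA, hcm⟩ := hc
      have h1 : 1 ≤ (F - c) / m := (Nat.one_le_div_iff hmpos).mpr hcm
      have h2 : (F - c) / m ≤ ∑ x ∈ (A.erase a).erase b, (F - x) / m :=
        Finset.single_le_sum (f := fun x => (F - x) / m) (fun _ _ => Nat.zero_le _) hcA
      calc D.card * (F / m) ≤ e * ∑ x ∈ A, (F - x) / m := by
            apply Nat.mul_le_mul hle; omega
        _ ≤ _ := Nat.le_add_right _ _
    push Not at hc
    -- Any other element exceeds F - m, so adding an element of A, which exceeds m, overshoots F.
    have hsmall : ∀ u ∈ A, ∀ v ∈ A, u + v ≤ F → u = a ∨ u = b := by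
      intro u hu v hv huv
      by_contra hcon
      push Not at hcon
      have := hc u (by simp [hcon.1, hcon.2, hu])
      have := hm v hv
      omega
    have hDsub : D ⊆ {2 * a, a + b, 2 * b} := by
      intro x hx
      obtain ⟨u, hu, v, hv, huv⟩ := hdec x hx
      have hxF := hF x (hDA hx)
      simp only [Finset.mem_insert, Finset.mem_singleton]
      rcases hsmall u hu v hv (by omega) with rfl | rfl <;>
        rcases hsmall v hv _ hu (by omega) with rfl | rfl <;> omega
    have hd3 : D.card ≤ 3 := (Finset.card_le_card hDsub).trans Finset.card_le_three
    have hQ : 2 ≤ F / m := by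
      rw [Nat.le_div_iff_mul_le hmpos]; omega
    -- Then F - a - b ≥ b - a ≥ 1, raising the slack from 2 to the 3 needed when |D| = 3.
    have hδ : D.card = 3 → 2 * b ≤ F := by
      intro h3
      have heq : D = {2 * a, a + b, 2 * b} :=
        Finset.eq_of_subset_of_card_le hDsub (by rw [h3]; exact Finset.card_le_three)
      exact hF _ (hDA (by rw [heq]; simp))
    have hS : F / m ≤ ∑ x ∈ A, (F - x) / m + 1 := by omega
    have hmul : e * (F / m) ≤ e * ∑ x ∈ A, (F - x) / m + e := by
      calc e * (F / m) ≤ e * (∑ x ∈ A, (F - x) / m + 1) := Nat.mul_le_mul_left _ hS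
        _ = _ := by ring
    obtain ⟨k, hk⟩ := Nat.exists_eq_add_of_le hle
    have hexp : e * (F / m) = D.card * (F / m) + k * (F / m) := by rw [← add_mul, ← hk]
    have hkQ : 2 * k ≤ k * (F / m) := by rw [mul_comm]; exact Nat.mul_le_mul_left _ hQ
    omega
  · have hd : D.card = 1 := by omega
    obtain ⟨u, hu, v, hv, huv⟩ := hdec x₀ hx₀
    have h2a : 2 * a ≤ F := by
      have := hF x₀ (hDA hx₀); have := hamin u hu; have := hamin v hv; omega
    have hx := Nat.div_add_mod (F - a) m
    have hxlt := Nat.mod_lt (F - a) hmpos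
    have hS : 2 * ((F - a) / m) ≤ e * ∑ x ∈ A, (F - x) / m :=
      Nat.mul_le_mul (by omega) (hsum ▸ Nat.le_add_right _ _)
    rw [hd, one_mul]
    -- Failure forces ⌊F/m⌋ = 2⌊(F - a)/m⌋ + 1 with slack 0, but F ≤ 2(F - a) gives F % m ≤ m - 2.
    by_contra hcon
    have hlt : m * (2 * ((F - a) / m) + 1) ≤ m * (F / m) := Nat.mul_le_mul_left _ (by omega)
    have hlt2 : m * (F / m) < m * (2 * ((F - a) / m) + 2) := by
      have : m * (2 * ((F - a) / m) + 2) = 2 * (m * ((F - a) / m)) + 2 * m := by ring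
      omega
    have hlt3 := Nat.lt_of_mul_lt_mul_left hlt2
    have : m * (2 * ((F - a) / m) + 1) = 2 * (m * ((F - a) / m)) + m := by ring
    omega

/-! ### Apéry sets, small elements and generators -/

open Classical in
/-- The Apéry set of `S` with respect to `m`, restricted to the elements at most `F`. -/
noncomputable def aperyUpTo (S : AddSubmonoid ℕ) (m F : ℕ) : Finset ℕ :=
  (Finset.range (F + 1)).filter fun s => s ∈ S ∧ ∀ t ∈ S, t + m ≠ s

theorem mem_aperyUpTo {S : AddSubmonoid ℕ} {m F s : ℕ} :
    s ∈ aperyUpTo S m F ↔ s ≤ F ∧ s ∈ S ∧ ∀ t ∈ S, t + m ≠ s := by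
  simp [aperyUpTo]

theorem zero_mem_aperyUpTo {S : AddSubmonoid ℕ} {m F : ℕ} (hm : 0 < m) :
    0 ∈ aperyUpTo S m F :=
  mem_aperyUpTo.mpr ⟨Nat.zero_le _, zero_mem _, fun t _ => by omega⟩

theorem eq_of_mem_aperyUpTo_of_add_mul_eq {S : AddSubmonoid ℕ} {m F x y k l : ℕ} (hm : m ∈ S)
    (hx : x ∈ aperyUpTo S m F) (hy : y ∈ aperyUpTo S m F) (h : x + k * m = y + l * m)
    (hkl : k ≤ l) : x = y := by
  obtain ⟨i, rfl⟩ := Nat.exists_eq_add_of_le hkl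
  rw [mem_aperyUpTo] at hx hy
  rcases i with _ | i
  · simpa using h
  · have hmem : y + i * m ∈ S := add_mem hy.2.1 (by simpa using nsmul_mem hm i)
    refine absurd ?_ (hx.2.2 _ hmem)
    have : (k + (i + 1)) * m = k * m + i * m + m := by ring
    omega

theorem eq_of_mem_aperyUpTo_of_mod_eq {S : AddSubmonoid ℕ} {m F x y : ℕ} (hm : m ∈ S)
    (hx : x ∈ aperyUpTo S m F) (hy : y ∈ aperyUpTo S m F) (h : x % m = y % m) : x = y := by
  have h1 := Nat.mod_add_div' x m
  have h2 := Nat.mod_add_div' y m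
  have h3 : x + y / m * m = y + x / m * m := by omega
  rcases le_total (y / m) (x / m) with h4 | h4
  · exact eq_of_mem_aperyUpTo_of_add_mul_eq hm hx hy h3 h4
  · exact (eq_of_mem_aperyUpTo_of_add_mul_eq hm hy hx h3.symm h4).symm

/-- The least element of S in each residue class is at most f + m, since otherwise subtracting m
would stay in S. -/
theorem card_aperyUpTo {S : AddSubmonoid ℕ} {m f : ℕ} (hm : m ∈ S) (hpos : 0 < m)
    (hf : ∀ s, f < s → s ∈ S) : (aperyUpTo S m (f + m)).card = m := by
  rw [← Finset.card_range m]
  refine Finset.card_bij (fun x _ => x % m)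
    (fun x _ => Finset.mem_range.mpr (Nat.mod_lt _ hpos))
    (fun x hx y hy h => ?_) fun r hr => ?_
  · rw [Finset.card_range] at hx hy
    exact eq_of_mem_aperyUpTo_of_mod_eq hm hx hy h
  · classical
    have hex : ∃ s, s ∈ S ∧ s % m = r := by
      refine ⟨r + (f + 1) * m, hf _ ?_, ?_⟩
      · have : (f + 1) * 1 ≤ (f + 1) * m := Nat.mul_le_mul_left _ hpos
        omega
      · rw [Nat.add_mul_mod_self_right, Nat.mod_eq_of_lt (Finset.mem_range.mp hr)]
    obtain ⟨h1, h2⟩ := Nat.find_spec hex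
    have hmin : ∀ t ∈ S, t + m ≠ Nat.find hex := by
      intro t ht he
      refine Nat.find_min hex (m := t) (by omega) ⟨ht, ?_⟩
      rw [← h2, ← he, Nat.add_mod_right]
    refine ⟨Nat.find hex, ?_, h2⟩
    rw [Finset.card_range, mem_aperyUpTo]
    refine ⟨?_, h1, hmin⟩
    by_contra hlt
    exact hmin (Nat.find hex - m) (hf _ (by omega)) (by omega)

/-- The elements x + k * m with x Apéry and k < (f + m - x) / m are distinct, lie in S and are at
most f, hence below f as f ∉ S. -/
theorem sum_aperyUpTo_le_numSmall {S : AddSubmonoid ℕ} {m f : ℕ} (hm : m ∈ S)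
    (hf : NumericalSemigroup.frobenius S = f) (hfS : f ∉ S) (hpos : 0 < m) :
    ∑ x ∈ aperyUpTo S m (f + m), (f + m - x) / m ≤ NumericalSemigroup.numSmall S := by
  classical
  rw [NumericalSemigroup.numSmall, hf]
  have hfin : {s : ℕ | s ∈ S ∧ (s : ℤ) < f}.Finite :=
    (Set.finite_Iio f).subset fun s hs => by simpa using hs.2
  have hcard : ∑ x ∈ aperyUpTo S m (f + m), (f + m - x) / m =
      ((aperyUpTo S m (f + m)).sigma fun x => Finset.range ((f + m - x) / m)).card := by
    simp [Finset.card_sigma]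
  rw [hcard, Set.ncard_eq_toFinset_card _ hfin]
  refine Finset.card_le_card_of_injOn (fun p => p.1 + p.2 * m) ?_ ?_
  · rintro ⟨x, k⟩ hp
    simp only [Finset.coe_sigma, Set.mem_sigma_iff, Finset.mem_coe, Finset.mem_range] at hp
    obtain ⟨hx, hk⟩ := hp
    have hk' : (k + 1) * m ≤ f + m - x := (Nat.le_div_iff_mul_le hpos).mp hk
    rw [mem_aperyUpTo] at hx
    have hmem : x + k * m ∈ S := add_mem hx.2.1 (by simpa using nsmul_mem hm k)
    have hne : x + k * m ≠ f := fun h => hfS (h ▸ hmem)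
    have : (k + 1) * m = k * m + m := by ring
    simp only [Set.Finite.coe_toFinset, Set.mem_ofPred_eq]
    exact ⟨hmem, by exact_mod_cast (by omega : x + k * m < f)⟩
  · rintro ⟨x, k⟩ hp ⟨y, l⟩ hq h
    simp only [Finset.coe_sigma, Set.mem_sigma_iff, Finset.mem_coe] at hp hq
    simp only at h
    have hxy : x = y := by
      rcases le_total k l with hkl | hkl
      · exact eq_of_mem_aperyUpTo_of_add_mul_eq hm hp.1 hq.1 h hkl
      · exact (eq_of_mem_aperyUpTo_of_add_mul_eq hm hq.1 hp.1 h.symm hkl).symm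
    subst hxy
    have hkl : k = l := Nat.eq_of_mul_eq_mul_right hpos (by omega)
    rw [hkl]

/-- Apéry sets are closed under summands: if m could be subtracted from a summand within S, it could
be from the sum. -/
theorem exists_add_eq_of_not_mem_minimalGenerators {S : AddSubmonoid ℕ} {m F x : ℕ}
    (hx : x ∈ (aperyUpTo S m F).erase 0) (hg : x ∉ NumericalSemigroup.minimalGenerators S) :
    ∃ u ∈ (aperyUpTo S m F).erase 0, ∃ v ∈ (aperyUpTo S m F).erase 0, u + v = x := by
  rw [Finset.mem_erase, mem_aperyUpTo] at hx
  obtain ⟨hx0, hxF, hxS, hxm⟩ := hx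
  have : ∃ u ∈ S, u ≠ 0 ∧ NumericalSemigroup.Below S u x ∧ u ≠ x := by
    by_contra hcon
    push Not at hcon
    exact hg ⟨hxS, hx0, hcon⟩
  obtain ⟨u, hu, hu0, ⟨v, hv, rfl⟩, hne⟩ := this
  refine ⟨u, ?_, v, ?_, rfl⟩ <;> rw [Finset.mem_erase, mem_aperyUpTo]
  · exact ⟨hu0, by omega, hu, fun t ht h => hxm (t + v) (add_mem ht hv) (by omega)⟩
  · exact ⟨by omega, by omega, hv, fun t ht h => hxm (u + t) (add_mem hu ht) (by omega)⟩

theorem minimalGenerators_eq_insert {S : AddSubmonoid ℕ} {m f : ℕ}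
    (hm : IsLeast {s : ℕ | s ∈ S ∧ 0 < s} m) (hf : ∀ s, f < s → s ∈ S) :
    NumericalSemigroup.minimalGenerators S =
      insert m {x | x ∈ (aperyUpTo S m (f + m)).erase 0 ∧
        x ∈ NumericalSemigroup.minimalGenerators S} := by
  ext g
  simp only [Set.mem_insert_iff, Set.mem_ofPred_eq, Finset.mem_erase, mem_aperyUpTo]
  constructor
  · intro hg
    by_cases hgm : g = m
    · exact Or.inl hgm
    have hno : ∀ t ∈ S, t + m ≠ g := fun t ht h =>
      hgm (hg.2.2 m hm.1.1 hm.1.2.ne' ⟨t, ht, by omega⟩).symm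
    refine Or.inr ⟨⟨hg.2.1, ?_, hg.1, hno⟩, hg⟩
    by_contra hlt
    exact hno (g - m) (hf _ (by omega)) (by omega)
  · rintro (rfl | h)
    · refine ⟨hm.1.1, hm.1.2.ne', fun s hs hs0 ⟨u, _, hu⟩ => ?_⟩
      have : g ≤ s := hm.2 ⟨hs, Nat.pos_of_ne_zero hs0⟩
      omega
    · exact h.2

theorem theorem2 (S : AddSubmonoid ℕ)
    (hS : NumericalSemigroup.IsNumericalSemigroup S)
    (h : NumericalSemigroup.multiplicity S ≤ 2 * NumericalSemigroup.embeddingDimension S) :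
    NumericalSemigroup.SatisfiesWilf S := by
  classical
  have hleast := NumericalSemigroup.isLeast_multiplicity hS
  obtain ⟨hfr, hub⟩ := NumericalSemigroup.isGreatest_frobenius hS
  rw [NumericalSemigroup.SatisfiesWilf]
  set m := NumericalSemigroup.multiplicity S with hmdef
  obtain ⟨hmS, hmpos⟩ := hleast.1
  -- A negative Frobenius number makes the left side at most 0.
  rcases lt_or_ge (NumericalSemigroup.frobenius S) 0 with hneg | hnn
  · have : (0 : ℤ) ≤ (NumericalSemigroup.numSmall S : ℤ) *
        (NumericalSemigroup.embeddingDimension S : ℤ) := by positivity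
    omega
  obtain ⟨f, hf⟩ := Int.eq_ofNat_of_zero_le hnn
  rw [hf] at hfr hub
  have hfS : f ∉ S := fun hmem => hfr ⟨f, hmem, rfl⟩
  have hgt : ∀ s, f < s → s ∈ S := by
    intro s hs
    by_contra hcon
    have : (s : ℤ) ≤ f := hub (by rintro ⟨t, ht, hts⟩; exact hcon (Int.ofNat.inj hts ▸ ht))
    omega
  have hcard := card_aperyUpTo hmS hmpos hgt
  have h0mem := zero_mem_aperyUpTo (S := S) (F := f + m) hmpos
  set A := (aperyUpTo S m (f + m)).erase 0 with hAdef
  have hA : A.card + 1 = m := by rw [hAdef, Finset.card_erase_add_one h0mem, hcard]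
  set D := A.filter (· ∉ NumericalSemigroup.minimalGenerators S) with hDdef
  have hmA : m ∉ A := by
    rw [hAdef, Finset.mem_erase, mem_aperyUpTo]
    exact fun hmem => hmem.2.2.2 0 (zero_mem _) (by omega)
  have hDe : D.card + NumericalSemigroup.embeddingDimension S = m := by
    have hgen : NumericalSemigroup.minimalGenerators S =
        ↑(insert m (A.filter (· ∈ NumericalSemigroup.minimalGenerators S))) := by
      rw [Finset.coe_insert, Finset.coe_filter]
      exact minimalGenerators_eq_insert hleast hgt
    have hcardgen : NumericalSemigroup.embeddingDimension S =
        (A.filter (· ∈ NumericalSemigroup.minimalGenerators S)).card + 1 := by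
      rw [NumericalSemigroup.embeddingDimension]
      conv_lhs => rw [hgen]
      rw [Set.ncard_coe_finset, Finset.card_insert_of_notMem (by simp [hmA])]
    have hsplit : (A.filter (· ∈ NumericalSemigroup.minimalGenerators S)).card + D.card = A.card :=
      Finset.card_filter_add_card_filter_not (s := A)
        (· ∈ NumericalSemigroup.minimalGenerators S)
    omega
  have hcore := card_mul_div_le (F := f + m) (D := D) (Finset.filter_subset _ A) hA hDe (by omega)
    (fun x hx => (mem_aperyUpTo.mp (Finset.mem_erase.mp hx).2).1)
    (fun x hx => by
      have hx' := hx
      rw [hAdef, Finset.mem_erase, mem_aperyUpTo] at hx'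
      have : m ≤ x := hleast.2 ⟨hx'.2.2.1, Nat.pos_of_ne_zero hx'.1⟩
      exact lt_of_le_of_ne this fun he => hmA (he ▸ hx))
    (fun x hx y hy => eq_of_mem_aperyUpTo_of_mod_eq hmS (Finset.mem_erase.mp hx).2
      (Finset.mem_erase.mp hy).2)
    (fun x hx => exists_add_eq_of_not_mem_minimalGenerators (Finset.mem_filter.mp hx).1
      (Finset.mem_filter.mp hx).2)
  have hn := sum_aperyUpTo_le_numSmall hmS hf hfS hmpos
  rw [← Finset.add_sum_erase _ _ h0mem, ← hAdef, Nat.sub_zero] at hn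
  rw [hf]
  set e := NumericalSemigroup.embeddingDimension S
  have hmul := Nat.mul_le_mul_left e hn
  rw [mul_add] at hmul
  have hdm := Nat.div_add_mod (f + m) m
  have hlt := Nat.mod_lt (f + m) hmpos
  have hexp : m * ((f + m) / m) = D.card * ((f + m) / m) + e * ((f + m) / m) := by
    rw [← add_mul, hDe]
  have hfinal : f + 1 ≤ NumericalSemigroup.numSmall S * e := by
    rw [mul_comm]
    omega
  exact_mod_cast hfinal
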